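/- Let $K$ be a field. For $n\ge 1$ and $g\in \mathrm{GL}_n(K)$ let $$\ell_{\mathrm r}(g)=\frac{\operatorname{rank}(1-g)}{n}\quad\text{(rank length)},\qquad \ell_{\mathrm J}(g)=\inf_{\alpha\in K^\times}\frac{\operatorname{rank}(\alpha-g)}{n}\quad\text{(Jordan length)}.$$ Let $\ell$ be one of these two. For a group $\Gamma$, numbers $\delta_g>0$ ($g\in\Gamma\setminus\{1\}$), a finite set $E\subset\Gamma$ and $\varepsilon>0$, a map $\varphi\colon\Gamma\to \mathrm{GL}_n(K)$ is an $(E,\varepsilon)$-homomorphism with respect to $(\delta_g)$ if $\ell(\varphi(1))\le\varepsilon$, $\ell(\varphi(g))\ge\delta_g$ for all $g\in E\setminus\{1\}$, and $\ell(\varphi(g)\varphi(h)\varphi(gh)^{-1})\le\varepsilon$ for all $g,h\in E$. The group $\Gamma$ is $K$-sofic (for $\ell=\ell_{\mathrm r}$), respectively projectively $K$-sofic (for $\ell=\ell_{\mathrm J}$), if there are numbers $\delta_g>0$ such that for all finite $E\subset \Gamma$ and all $\varepsilon>0$ there are $n\ge1$ and an $(E,\varepsilon)$-homomorphism $\Gamma\to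 \mathrm{GL}_n(K)$ with respect to $(\delta_g)$. **Theorem.** (1) The class $\{\mathrm{GL}_n(K) : n\ge 1\}$ has the amplification property, both with $\ell=\ell_{\mathrm r}$ and with $\ell=\ell_{\mathrm J}$: there is $\delta>0$ such that for every group $\Gamma$, all numbers $\delta_g>0$ ($g\in\Gamma\setminus\{1\}$), all $\varepsilon>0$ and all $c>0$ there is $\varepsilon'>0$ such that the following holds. For every finite $E\subset\Gamma$ with $\delta_g\ge c$ for all $g\in E\setminus\{1\}$, every $n\ge1$ and every $(E,\varepsilon')$-homomorphism $\varphi\colon\Gamma\to \mathrm{GL}_n(K)$ with respect to $(\delta_g)$, there are $m\ge1$ and a map $\kappa\colon \mathrm{GL}_n(K)\to \mathrm{GL}_m(K)$ such that $\kappa\circ\varphi$ is an $(E,\varepsilon)$-homomorphism with respect to the constant numbers $\delta$; in particular $\ell(\kappa(\varphi(g)))\ge\delta$ for all $g\in E\setminus\{1\}$. (2) If $\Gamma$ is projectively $K$-sofic, then there are numbers $\delta_g>0$ ($g\in\Gamma\setminus\{1\}$) such that for every finite $E\subset\Gamma$ and every $\varepsilon>0$ there are $n\ge1$ and an $(E,\varepsilon)$-homomorphism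 $\varphi\colon\Gamma\to \mathrm{GL}_n(K)$ with respect to $\ell_{\mathrm J}$ and $(\delta_g)$ such that $\ell_{\mathrm J}(\varphi(g))>\frac14-\varepsilon$ for all $g\in E\setminus\{1\}$. (3) If $\Gamma$ is $K$-sofic, then there are numbers $\delta_g>0$ ($g\in\Gamma\setminus\{1\}$) such that for every finite $E\subset\Gamma$ and every $\varepsilon>0$ there are $n\ge1$ and an $(E,\varepsilon)$-homomorphism $\varphi\colon\Gamma\to \mathrm{GL}_n(K)$ with respect to $\ell_{\mathrm r}$ and $(\delta_g)$ such that $\ell_{\mathrm r}(\varphi(g))>\frac18-\varepsilon$ for all $g\in E\setminus\{1\}$. -/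

import Mathlib

universe u v w x

/-- `φ : Γ → G` is an `(E, ε)`-homomorphism with respect to the (pseudo) length function `ℓ` on `G`
and the distribution `d` of lower bounds `d g` for the elements `g ≠ 1` of `Γ`. -/
structure IsAlmostHom {Γ : Type u} [Group Γ] {G : Type v} [Group G] (ℓ : G → ℝ) (d : Γ → ℝ)
    (E : Finset Γ) (ε : ℝ) (φ : Γ → G) : Prop where
  length_map_one_le : ℓ (φ 1) ≤ ε
  le_length_map : ∀ g ∈ E, g ≠ 1 → d g ≤ ℓ (φ g)
  length_defect_le : ∀ g ∈ E, ∀ h ∈ E, ℓ (φ g * φ h * (φ (g * h))⁻¹) ≤ ε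

/-- The group `Γ` has the approximation property with respect to the class of groups `G i`,
`i : I`, with (pseudo) length functions `ℓ i`: there are numbers `d g > 0`, for `g ≠ 1`, such that
all finite `E` and all `ε > 0` admit an `(E, ε)`-homomorphism into some `G i`. -/
def ApproximationProperty {I : Type w} (G : I → Type v) [∀ i, Group (G i)] (ℓ : ∀ i, G i → ℝ)
    (Γ : Type u) [Group Γ] : Prop :=
  ∃ d : Γ → ℝ, (∀ g : Γ, g ≠ 1 → 0 < d g) ∧
    ∀ ε : ℝ, 0 < ε → ∀ E : Finset Γ, ∃ (i : I) (φ : Γ → G i), IsAlmostHom (ℓ i) d E ε φ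

/-- The amplification property of the class of groups `G i`, `i : I`, with (pseudo) length
functions `ℓ i`. There is a universal `δ > 0` such that every sufficiently good
`(E, ε')`-homomorphism `φ` (with respect to lower bounds `d g > 0`) can be composed with a map
`κ` into another group of the class so that `κ ∘ φ` is an `(E, ε)`-homomorphism all of whose
lengths on `E \ {1}` are at least `δ`. The number `ε'` depends on `Γ`, `d`, `ε`, and on `E` only
through a lower bound `c > 0` of the numbers `d g`, `g ∈ E \ {1}`. -/
def AmplificationProperty {I : Type w} (G : I → Type v) [∀ i, Group (G i)]
    (ℓ : ∀ i, G i → ℝ) : Prop :=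
  ∃ δ : ℝ, 0 < δ ∧
    ∀ (Γ : Type u) [Group Γ] (d : Γ → ℝ), (∀ g : Γ, g ≠ 1 → 0 < d g) →
    ∀ ε : ℝ, 0 < ε → ∀ c : ℝ, 0 < c → ∃ ε' : ℝ, 0 < ε' ∧
      ∀ E : Finset Γ, (∀ g ∈ E, g ≠ 1 → c ≤ d g) →
      ∀ (i : I) (φ : Γ → G i), IsAlmostHom (ℓ i) d E ε' φ →
        ∃ (j : I) (κ : G i → G j), IsAlmostHom (ℓ j) (fun _ => δ) E ε (κ ∘ φ)

/-- The rank length on `GL_n(K)`. -/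
noncomputable def rankLength (K : Type x) [Field K] (n : ℕ+) (g : GL (Fin n) K) : ℝ :=
  ((1 - (g : Matrix (Fin n) (Fin n) K)).rank : ℝ) / (n : ℕ)

/-- The Jordan length on `GL_n(K)`. -/
noncomputable def jordanLength (K : Type x) [Field K] (n : ℕ+) (g : GL (Fin n) K) : ℝ :=
  ⨅ α : Kˣ, (((α : K) • 1 - (g : Matrix (Fin n) (Fin n) K)).rank : ℝ) / (n : ℕ)

/-- `K`-sofic groups: approximation in the groups `GL_n(K)`, `n ≥ 1`, with the rank length. -/
def IsSoficOver (K : Type x) [Field K] (Γ : Type u) [Group Γ] : Prop :=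
  ApproximationProperty (fun n : ℕ+ => GL (Fin n) K) (rankLength K) Γ

/-- Projectively `K`-sofic groups: approximation in the groups `GL_n(K)`, `n ≥ 1`, with the
Jordan length. -/
def IsProjectivelySoficOver (K : Type x) [Field K] (Γ : Type u) [Group Γ] : Prop :=
  ApproximationProperty (fun n : ℕ+ => GL (Fin n) K) (jordanLength K) Γ

/-! The amplifier is an iterated tensor square. The homomorphism `g ↦ g ⊗ g` at most doubles both
lengths, so `i` squarings multiply defects by at most `2 ^ i`. Since `i` depends only on the lower
bound `c`, a small `ε'` absorbs this factor.

The gain is `min_le_jordanLength_tensorSquare`: the Jordan length grows by the factor `5 / 4` until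
it reaches `1 / 4`. Let `r` be the minimal rank of `μ - g` over units `μ`. If `r > n / 2`, then `g`
is far from all scalars, so some `U` of dimension at least `n / 4` meets `g U` trivially, and `α - g
⊗ g` is injective on `U ⊗ Kⁿ`. If `r ≤ n / 2`, the large space `ker (μ - g)` bounds the rank from
below, separately for `α ≠ μ²` and `α = μ²`.

Squaring may kill the rank length, as `(-1) ⊗ (-1) = 1` shows. Hence `g` is first replaced by `g ⊕
1`, whose Jordan length is at least half the rank length of `g`. As the Jordan length is at most the
rank length, `1 / 4` is reached for both. -/

open TensorProduct Module

/-! ### Ranks of `α - h ⊗ g` for linear maps. -/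

namespace LinearMap

variable {K V W U₁ U₂ : Type*} [Field K] [AddCommGroup V] [Module K V] [AddCommGroup W] [Module K W]
  [AddCommGroup U₁] [Module K U₁] [AddCommGroup U₂] [Module K U₂]

theorem coprod_rTensor_injective (f₁ : U₁ →ₗ[K] V) (f₂ : U₂ →ₗ[K] V)
    (h : Function.Injective (f₁.coprod f₂)) :
    Function.Injective ((f₁.rTensor W).coprod (f₂.rTensor W)) := by
  have key : (f₁.rTensor W).coprod (f₂.rTensor W) =
      ((f₁.coprod f₂).rTensor W) ∘ₗ (TensorProduct.prodLeft K K U₁ U₂ W).symm.toLinearMap := by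
    rw [LinearEquiv.eq_comp_toLinearMap_symm]
    ext <;> simp
  rw [key, LinearMap.coe_comp]
  exact (Module.Flat.rTensor_preserves_injective_linearMap _ h).comp (LinearEquiv.injective _)

theorem coprod_subtype_injective {U U' : Submodule K V} (h : Disjoint U U') :
    Function.Injective (U.subtype.coprod U'.subtype) := by
  rw [← LinearMap.ker_eq_bot, LinearMap.ker_coprod_of_disjoint_range]
  · simp
  · simpa using h

/-- Independence of `U` and `U'` alone makes `U ⊗ A` and `U' ⊗ A'` independent, so their dimensions
add. -/
theorem finrank_mul_add_finrank_mul_le_finrank_of_range_mapIncl_le [FiniteDimensional K V]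
    [FiniteDimensional K W] {U U' : Submodule K V} (h : Disjoint U U') (A A' : Submodule K W)
    {R : Submodule K (V ⊗[K] W)} (hR : range (mapIncl U A) ≤ R) (hR' : range (mapIncl U' A') ≤ R) :
    finrank K U * finrank K A + finrank K U' * finrank K A' ≤ finrank K R := by
  have key : Function.Injective ((mapIncl U A).coprod (mapIncl U' A')) := by
    have e : (mapIncl U A).coprod (mapIncl U' A') =
        ((U.subtype.rTensor W).coprod (U'.subtype.rTensor W)) ∘ₗ
          ((A.subtype.lTensor U).prodMap (A'.subtype.lTensor U')) := by
      ext <;> simp [mapIncl]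
    rw [e, LinearMap.coe_comp]
    refine (coprod_rTensor_injective _ _ (coprod_subtype_injective h)).comp ?_
    exact Function.Injective.prodMap
      (Module.Flat.lTensor_preserves_injective_linearMap _ A.injective_subtype)
      (Module.Flat.lTensor_preserves_injective_linearMap _ A'.injective_subtype)
  have h1 := LinearMap.finrank_range_of_inj key
  rw [finrank_prod, finrank_tensorProduct, finrank_tensorProduct] at h1
  rw [← h1]
  apply Submodule.finrank_mono
  rw [LinearMap.range_coprod]
  exact sup_le hR hR'

theorem finrank_le_finrank_range_of_injective_comp [FiniteDimensional K V] (T : V →ₗ[K] W)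
    (f : U₁ →ₗ[K] V) (h : Function.Injective (T ∘ₗ f)) : finrank K U₁ ≤ finrank K (range T) := by
  rw [← LinearMap.finrank_range_of_inj h]
  exact Submodule.finrank_mono (LinearMap.range_comp_le_range f T)

theorem finrank_range_map_le [FiniteDimensional K V] [FiniteDimensional K W]
    (f : V →ₗ[K] V) (g : W →ₗ[K] W) :
    finrank K (range (TensorProduct.map f g)) ≤ finrank K (range f) * finrank K (range g) := by
  have e : TensorProduct.map f g =
      mapIncl (range f) (range g) ∘ₗ TensorProduct.map f.rangeRestrict g.rangeRestrict := by
    ext; simp [mapIncl]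
  rw [e, ← finrank_tensorProduct (R := K) (S := K)]
  exact (Submodule.finrank_mono (LinearMap.range_comp_le_range _ _)).trans
    (LinearMap.finrank_range_le _)

/-- If `U ∩ h U = 0`, then `α - h ⊗ g` is injective on `U ⊗ W`. -/
theorem finrank_mul_le_finrank_range_smul_sub_map [FiniteDimensional K V] [FiniteDimensional K W]
    {h : V →ₗ[K] V} (hh : Function.Injective h) (g : W →ₗ[K] W) {α : K} (hα : α ≠ 0)
    {U : Submodule K V} (hU : Disjoint U (U.map h)) :
    finrank K U * finrank K W ≤ finrank K (range (α • id - TensorProduct.map h g)) := by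
  rw [← finrank_tensorProduct (R := K) (S := K)]
  refine finrank_le_finrank_range_of_injective_comp _ (U.subtype.rTensor W) ?_
  have hi : Function.Injective (U.subtype.coprod (h ∘ₗ U.subtype)) := by
    rw [← LinearMap.ker_eq_bot, LinearMap.ker_coprod_of_disjoint_range]
    · rw [LinearMap.ker_eq_bot.2 U.injective_subtype,
        LinearMap.ker_eq_bot.2 (by exact hh.comp U.injective_subtype)]
      simp
    · simpa [LinearMap.range_comp] using hU
  -- The terms `α` and `h ⊗ g` land in the independent subspaces `U ⊗ W` and `h U ⊗ W`, and the
  -- first is already injective.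
  have e : (α • id - TensorProduct.map h g) ∘ₗ U.subtype.rTensor W =
      ((U.subtype.rTensor W).coprod ((h ∘ₗ U.subtype).rTensor W)) ∘ₗ
        (LinearMap.prod (α • id) (-g.lTensor U)) := by
    ext; simp [sub_eq_add_neg]
  rw [e, LinearMap.coe_comp]
  refine (coprod_rTensor_injective _ _ hi).comp ?_
  intro a b hab
  have := congrArg Prod.fst hab
  simpa [hα] using this

/-- There is a subspace `U` with `U ∩ h U = 0` which is large unless `h` is close to a scalar: if `U`
is maximal with this property, then `U + h U` has codimension at most one, or `h` is congruent to a
scalar modulo `U + h U`. -/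
theorem exists_disjoint_map_and_finrank_le [FiniteDimensional K V] (h : V →ₗ[K] V) :
    ∃ U : Submodule K V, Disjoint U (U.map h) ∧
      (finrank K V ≤ 2 * finrank K U + 1 ∨
        ∃ β : K, finrank K (range (β • id - h)) ≤ 2 * finrank K U) := by
  obtain ⟨U, hU, hmax⟩ := (wellFounded_gt (α := Submodule K V)).has_min
    {U | Disjoint U (U.map h)} ⟨⊥, by simp⟩
  refine ⟨U, hU, ?_⟩
  set Z : Submodule K V := U ⊔ U.map h with hZ
  have hZrank : finrank K Z ≤ 2 * finrank K U := by
    have h1 := Submodule.finrank_add_le_finrank_add_finrank U (U.map h)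
    have h2 := Submodule.finrank_map_le h U
    rw [← hZ] at h1
    omega
  -- By maximality, adjoining `v` to `U` destroys disjointness; a common nonzero vector is a linear
  -- relation between `v` and `h v` modulo `Z`.
  have hdep : ∀ v : V, v ∉ Z → ∃ c : K, Z.mkQ (h v) = c • Z.mkQ v := by
    intro v hv
    have hvU : v ∉ U := fun hv' => hv (Submodule.mem_sup_left hv')
    have hlt : U < U ⊔ Submodule.span K {v} := by
      refine lt_of_le_of_ne le_sup_left fun e => hvU ?_
      rw [e]
      exact Submodule.mem_sup_right (Submodule.mem_span_singleton_self v)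
    have hnd : ¬ Disjoint (U ⊔ Submodule.span K {v}) ((U ⊔ Submodule.span K {v}).map h) :=
      fun hd => hmax _ hd hlt
    rw [Submodule.disjoint_def] at hnd
    push Not at hnd
    obtain ⟨y, hy, hy', hy0⟩ := hnd
    obtain ⟨y', hy', rfl⟩ := hy'
    obtain ⟨u, hu, p, hp, hup⟩ := Submodule.mem_sup.1 hy
    obtain ⟨u', hu', q, hq, rfl⟩ := Submodule.mem_sup.1 hy'
    obtain ⟨a, rfl⟩ := Submodule.mem_span_singleton.1 hp
    obtain ⟨b, rfl⟩ := Submodule.mem_span_singleton.1 hq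
    have hmem : b • h v - a • v ∈ Z := by
      have : b • h v - a • v = u - h u' := by
        rw [map_add, map_smul] at hup
        rw [sub_eq_sub_iff_add_eq_add, hup, add_comm]
      rw [this]
      exact Z.sub_mem (Submodule.mem_sup_left hu)
        (Submodule.mem_sup_right (Submodule.mem_map_of_mem hu'))
    have hb : b ≠ 0 := by
      rintro rfl
      have ha : a = 0 := by
        by_contra ha
        rw [zero_smul, zero_sub, neg_mem_iff, Submodule.smul_mem_iff _ ha] at hmem
        exact hv hmem
      subst ha
      simp only [zero_smul, add_zero] at hup hy0
      exact hy0 (Submodule.disjoint_def.1 hU _ (hup ▸ hu) (Submodule.mem_map_of_mem hu'))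
    refine ⟨b⁻¹ * a, ?_⟩
    have h0 : b • Z.mkQ (h v) = a • Z.mkQ v := by
      rw [← sub_eq_zero, ← map_smul Z.mkQ, ← map_smul Z.mkQ, ← map_sub]
      exact (Submodule.Quotient.mk_eq_zero Z).2 hmem
    rw [mul_smul, ← h0, inv_smul_smul₀ hb]
  by_cases hQ : finrank K (V ⧸ Z) ≤ 1
  · left
    have := Z.finrank_quotient_add_finrank
    omega
  right
  -- If `h z ∉ Z` for some `z ∈ Z`, comparing `hdep` at `v` and `v + z` makes every `v ∉ Z`
  -- proportional to `h z` modulo `Z`, so `V ⧸ Z` is a line.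
  have hZh : Z ≤ Z.comap h := by
    intro z hz
    rw [Submodule.mem_comap]
    by_contra hw
    refine hQ (finrank_le_one (Z.mkQ (h z)) fun q => ?_)
    obtain ⟨v, rfl⟩ := Z.mkQ_surjective q
    by_cases hv : v ∈ Z
    · exact ⟨0, by rw [zero_smul, eq_comm]; simpa using hv⟩
    have hvz : v + z ∉ Z := fun h' => hv ((Z.add_mem_iff_left hz).1 h')
    obtain ⟨c, hc⟩ := hdep v hv
    obtain ⟨c', hc'⟩ := hdep (v + z) hvz
    have hz0 : Z.mkQ z = 0 := by simpa using hz
    have e : Z.mkQ (h z) = (c' - c) • Z.mkQ v := by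
      rw [map_add, map_add, map_add, hc, hz0, add_zero] at hc'
      rw [sub_smul, ← hc', add_sub_cancel_left]
    have hcc : c' - c ≠ 0 := by
      intro h0
      rw [h0, zero_smul] at e
      exact hw (by simpa using e)
    exact ⟨(c' - c)⁻¹, by rw [e, inv_smul_smul₀ hcc]⟩
  -- Every nonzero vector of `V ⧸ Z` is an eigenvector of the induced map, which is therefore
  -- scalar.
  obtain ⟨β, hβ⟩ := LinearMap.exists_eq_smul_id_of_forall_notLinearIndependent
    (f := Z.mapQ Z h hZh) (fun q hq => by
      obtain ⟨v, rfl⟩ := Z.mkQ_surjective q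
      have hv : v ∉ Z := fun hv => hq.ne_zero 0 (by simpa using hv)
      obtain ⟨c, hc⟩ := hdep v hv
      have hq0 : Z.mkQ v ≠ 0 := hq.ne_zero 0
      exact (LinearIndependent.pair_iff' hq0).1 hq c hc.symm)
  refine ⟨β, le_trans (Submodule.finrank_mono ?_) hZrank⟩
  rintro _ ⟨v, rfl⟩
  have := LinearMap.congr_fun hβ (Z.mkQ v)
  rw [← Submodule.Quotient.mk_eq_zero]
  simp only [Submodule.mkQ_apply, Submodule.mapQ_apply] at this
  simp [this]

/-- If `g = μ + N`, then `μ² - g ⊗ g` has rank at least `2 r n - 3 r²`, where `r` is the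
rank of `N`. -/
theorem finrank_range_sq_smul_sub_map [FiniteDimensional K V] (g : V →ₗ[K] V) {μ : K} (hμ : μ ≠ 0) :
    2 * finrank K (range (μ • id - g)) * finrank K V ≤
      finrank K (range ((μ * μ) • id - TensorProduct.map g g)) +
        3 * finrank K (range (μ • id - g)) ^ 2 := by
  set N := μ • id - g with hN
  have hg : ∀ x, g x = μ • x - N x := fun x => by simp [hN]
  -- `ker N ⊓ C` is a part of `ker N` independent of `range N`, of dimension at least `n - 2r`.
  obtain ⟨C, hC⟩ := (ker N ⊓ range N).exists_isCompl
  have hdisj : Disjoint (range N) (ker N ⊓ C) := by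
    rw [disjoint_iff_inf_le, ← hC.inf_eq_bot]
    exact le_inf (le_inf (inf_le_right.trans inf_le_left) inf_le_left)
      (inf_le_right.trans inf_le_right)
  have hker : finrank K (ker N) ≤ finrank K (range N) + finrank K ↥(ker N ⊓ C) := by
    have e : ker N = (ker N ⊓ range N) ⊔ (ker N ⊓ C) := by
      rw [inf_comm (ker N) C, ← sup_inf_assoc_of_le C inf_le_left, hC.sup_eq_top, top_inf_eq]
    have h1 := Submodule.finrank_add_le_finrank_add_finrank (ker N ⊓ range N) (ker N ⊓ C)
    rw [← e] at h1
    have h2 : finrank K ↥(ker N ⊓ range N) ≤ finrank K (range N) :=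
      Submodule.finrank_mono inf_le_right
    omega
  -- For `a ∈ ker N` the map sends `x ⊗ a` to `μ N x ⊗ a`, and symmetrically `a ⊗ x` to `μ a ⊗ N x`.
  -- The count is `r (n - r) + (n - 2r) r`.
  have key := finrank_mul_add_finrank_mul_le_finrank_of_range_mapIncl_le hdisj (ker N) (range N)
    (R := range ((μ * μ) • id - TensorProduct.map g g)) ?_ ?_
  · have hn := N.finrank_range_add_finrank_ker
    rw [← hn]
    nlinarith
  · rw [range_mapIncl, Submodule.map₂_le]
    rintro _ ⟨x, rfl⟩ a ha
    refine ⟨μ⁻¹ • (x ⊗ₜ a), ?_⟩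
    have hga : g a = μ • a := by rw [hg, mem_ker.1 ha, sub_zero]
    simp [hga, hg x, sub_tmul, smul_sub, smul_tmul', tmul_smul, smul_smul, hμ]
  · rw [range_mapIncl, Submodule.map₂_le]
    rintro a ⟨ha, -⟩ _ ⟨x, rfl⟩
    refine ⟨μ⁻¹ • (a ⊗ₜ x), ?_⟩
    have hga : g a = μ • a := by rw [hg, mem_ker.1 ha, sub_zero]
    simp [hga, hg x, tmul_sub, smul_tmul', tmul_smul, smul_smul, hμ]

/-- On the tensor square of the eigenspace, `α - g ⊗ g` is the nonzero scalar `α - μ²`. -/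
theorem sq_finrank_ker_le_finrank_range_smul_sub_map [FiniteDimensional K V] (g : V →ₗ[K] V)
    {μ α : K} (hα : α ≠ μ * μ) :
    finrank K (ker (μ • id - g)) ^ 2 ≤ finrank K (range (α • id - TensorProduct.map g g)) := by
  rw [sq, ← finrank_tensorProduct (R := K) (S := K)]
  refine finrank_le_finrank_range_of_injective_comp _ (mapIncl _ _) ?_
  have e : (α • id - TensorProduct.map g g) ∘ₗ mapIncl (ker (μ • id - g)) (ker (μ • id - g)) =
      (α - μ * μ) • mapIncl (ker (μ • id - g)) (ker (μ • id - g)) := by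
    ext x y
    have hx : g x = μ • (x : V) := (sub_eq_zero.1 x.2).symm
    have hy : g y = μ • (y : V) := (sub_eq_zero.1 y.2).symm
    simp [mapIncl, hx, hy, sub_smul, TensorProduct.smul_tmul', TensorProduct.tmul_smul, smul_smul]
  rw [e]
  have hi : Function.Injective (mapIncl (ker (μ • id - g)) (ker (μ • id - g))) :=
    TensorProduct.map_injective_of_flat_flat _ _ (Submodule.injective_subtype _)
      (Submodule.injective_subtype _)
  intro a b hab
  exact hi (smul_right_injective _ (sub_ne_zero.2 hα) hab)

end LinearMap

/-! ### Ranks of Kronecker squares of matrices. -/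

open scoped Kronecker

namespace Matrix

theorem rank_add_le {K m n : Type*} [Field K] [Finite m] [Fintype n] (A B : Matrix m n K) :
    (A + B).rank ≤ A.rank + B.rank := by
  unfold rank
  rw [mulVecLin_add]
  refine (Submodule.finrank_mono (LinearMap.range_add_le _ _)).trans ?_
  exact Submodule.finrank_add_le_finrank_add_finrank _ _

variable {K ι κ : Type*} [Field K] [Fintype ι] [DecidableEq ι] [Fintype κ] [DecidableEq κ]

theorem rank_eq_finrank_range_toLin' (A : Matrix ι ι K) :
    A.rank = finrank K (LinearMap.range (toLin' A)) := by
  rw [← toLin_eq_toLin']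
  exact rank_eq_finrank_range_toLin A (Pi.basisFun K ι) (Pi.basisFun K ι)

theorem rank_kronecker_le (A : Matrix ι ι K) (B : Matrix κ κ K) :
    (A ⊗ₖ B).rank ≤ A.rank * B.rank := by
  rw [rank_eq_finrank_range_toLin _ ((Pi.basisFun K ι).tensorProduct (Pi.basisFun K κ))
      ((Pi.basisFun K ι).tensorProduct (Pi.basisFun K κ)), toLin_kronecker,
    rank_eq_finrank_range_toLin', rank_eq_finrank_range_toLin']
  exact LinearMap.finrank_range_map_le _ _

theorem rank_smul_one_sub (β : K) (A : Matrix ι ι K) :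
    (β • 1 - A).rank = finrank K (LinearMap.range (β • LinearMap.id - toLin' A)) := by
  rw [rank_eq_finrank_range_toLin', map_sub, map_smul, toLin'_one]

theorem rank_smul_one_sub_kronecker (α : K) (A : Matrix ι ι K) (B : Matrix κ κ K) :
    (α • 1 - A ⊗ₖ B).rank = finrank K (LinearMap.range
      (α • LinearMap.id - TensorProduct.map (toLin' A) (toLin' B))) := by
  rw [rank_eq_finrank_range_toLin _ ((Pi.basisFun K ι).tensorProduct (Pi.basisFun K κ))
      ((Pi.basisFun K ι).tensorProduct (Pi.basisFun K κ)), map_sub, toLin_kronecker, map_smul,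
      toLin_one]
  rfl

theorem rank_mul_smul_one_sub_kronecker_le (α : K) (A : Matrix ι ι K) :
    ((α * α) • 1 - A ⊗ₖ A).rank ≤ 2 * Fintype.card ι * (α • 1 - A).rank := by
  have e : (α * α) • 1 - A ⊗ₖ A =
      (α • 1 - A) ⊗ₖ (α • (1 : Matrix ι ι K)) + A ⊗ₖ (α • 1 - A) := by
    have h1 : ∀ X Y Z : Matrix ι ι K, (X - Y) ⊗ₖ Z = X ⊗ₖ Z - Y ⊗ₖ Z := by
      intros; ext; simp [sub_mul]
    have h2 : ∀ X Y Z : Matrix ι ι K, Z ⊗ₖ (X - Y) = Z ⊗ₖ X - Z ⊗ₖ Y := by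
      intros; ext; simp [mul_sub]
    rw [h1, h2, smul_kronecker, kronecker_smul, one_kronecker_one, smul_smul]
    abel
  rw [e]
  refine (rank_add_le _ _).trans ?_
  have h1 := rank_kronecker_le (α • 1 - A) (α • (1 : Matrix ι ι K))
  have h2 := rank_kronecker_le A (α • 1 - A)
  have h3 := rank_le_card_width (α • (1 : Matrix ι ι K))
  have h4 := rank_le_card_width A
  nlinarith

/-- A lower bound for the rank of `α - A ⊗ A` in terms of the ranks of the matrices `β - A`. -/
theorem min_le_rank_smul_one_sub_kronecker (A : GL ι K) (μ α : Kˣ)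
    (hμ : ∀ β : Kˣ, ((μ : K) • 1 - (A : Matrix ι ι K)).rank ≤
      ((β : K) • 1 - (A : Matrix ι ι K)).rank) :
    min ((Fintype.card ι : ℝ) ^ 2 / 4 : ℝ)
      (5 / 4 * (Fintype.card ι : ℝ) * (((μ : K) • 1 - (A : Matrix ι ι K)).rank : ℝ)) ≤
      (((α : K) • 1 - (A : Matrix ι ι K) ⊗ₖ (A : Matrix ι ι K)).rank : ℝ) := by
  set n := Fintype.card ι with hn
  set r := ((μ : K) • 1 - (A : Matrix ι ι K)).rank with hr
  have hV : finrank K (ι → K) = n := Module.finrank_fintype_fun_eq_card K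
  have hrn : r ≤ n := rank_le_card_width _
  have hinj : Function.Injective (toLin' (A : Matrix ι ι K)) := by
    rw [toLin'_apply', mulVecLin, LinearMap.coe_mk]
    exact mulVec_injective_of_isUnit A.isUnit
  rw [rank_smul_one_sub_kronecker]
  rw [rank_smul_one_sub] at hr
  rcases lt_or_ge n (2 * r) with hlarge | hsmall
  · obtain ⟨U, hU, hcase⟩ := LinearMap.exists_disjoint_map_and_finrank_le (toLin' (A : Matrix ι ι K))
    have key := LinearMap.finrank_mul_le_finrank_range_smul_sub_map hinj
      (toLin' (A : Matrix ι ι K)) α.ne_zero hU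
    rw [hV] at key hcase
    have hU4 : n ≤ 4 * finrank K U := by
      rcases hcase with hc | ⟨β, hβ⟩
      -- For `n ≥ 2` the bound `n ≤ 2 dim U + 1` forces `U ≠ 0`, hence `n ≤ 4 dim U`. For `n = 1`
      -- the matrix is scalar and `r = 0`, which is excluded here.
      · rcases Nat.lt_or_ge n 2 with h2 | h2
        · exfalso
          obtain ⟨c, hc, -⟩ := LinearMap.existsUnique_eq_smul_id_of_finrank_eq_one
            (R := K) (M := ι → K) (by omega) (toLin' (A : Matrix ι ι K))
          have hc0 : c ≠ 0 := by
            rintro rfl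
            have := LinearMap.finrank_range_of_inj hinj
            rw [hc, zero_smul, LinearMap.range_zero, finrank_bot, hV] at this
            omega
          have := hμ (Units.mk0 c hc0)
          rw [rank_smul_one_sub, Units.val_mk0, hc, sub_self,
            LinearMap.range_zero, finrank_bot] at this
          omega
        · omega
      · have : r ≤ finrank K (LinearMap.range (β • LinearMap.id - toLin' (A : Matrix ι ι K))) := by
          -- Minimality of `r` concerns units only; for `β = 0` the rank is `n` because `A` is
          -- invertible.
          by_cases hβ0 : β = 0
          · subst hβ0
            rw [zero_smul, zero_sub, LinearMap.range_neg, LinearMap.finrank_range_of_inj hinj, hV]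
            exact hrn
          · have := hμ (Units.mk0 β hβ0)
            rwa [rank_smul_one_sub, Units.val_mk0] at this
        omega
    refine (min_le_left _ _).trans ?_
    have h1 : n ^ 2 ≤ 4 * finrank K (LinearMap.range ((α : K) • LinearMap.id -
        TensorProduct.map (toLin' (A : Matrix ι ι K)) (toLin' (A : Matrix ι ι K)))) := by
      nlinarith
    have h2 : (n : ℝ) ^ 2 ≤ 4 * (finrank K (LinearMap.range ((α : K) • LinearMap.id -
        TensorProduct.map (toLin' (A : Matrix ι ι K)) (toLin' (A : Matrix ι ι K)))) : ℝ) := by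
      exact_mod_cast h1
    linarith
  · by_cases hα : (α : K) = μ * μ
    · have key := LinearMap.finrank_range_sq_smul_sub_map (toLin' (A : Matrix ι ι K)) μ.ne_zero
      rw [← hα, ← hr, hV] at key
      have key' := (Nat.cast_le (α := ℝ)).2 key
      have hs : (2 : ℝ) * r ≤ n := by exact_mod_cast hsmall
      have hr0 : (0 : ℝ) ≤ r := r.cast_nonneg
      push_cast at key'
      -- `2rn - 3r²` is at least `5rn / 4` when `r ≤ n / 4`, and at least `n² / 4` when `n / 4 ≤ r ≤
      -- n / 2`.
      rcases le_total (4 * (r : ℝ)) n with h4 | h4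
      · refine (min_le_right _ _).trans ?_
        nlinarith
      · refine (min_le_left _ _).trans ?_
        nlinarith
    · have key := LinearMap.sq_finrank_ker_le_finrank_range_smul_sub_map
        (toLin' (A : Matrix ι ι K)) hα
      have hk := LinearMap.finrank_range_add_finrank_ker
        ((μ : K) • LinearMap.id - toLin' (A : Matrix ι ι K))
      rw [hV, ← hr] at hk
      refine (min_le_left _ _).trans ?_
      have key' := (Nat.cast_le (α := ℝ)).2 key
      have hk' : (n : ℝ) ≤ 2 * (finrank K (LinearMap.ker
          ((μ : K) • LinearMap.id - toLin' (A : Matrix ι ι K))) : ℝ) := by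
        exact_mod_cast (by omega)
      push_cast at key'
      have hn0 : (0 : ℝ) ≤ n := n.cast_nonneg
      nlinarith

end Matrix

/-! ### Lengths of `g ⊗ g` and `g ⊕ 1`. -/

section Lengths

variable {K : Type x} [Field K] {n : ℕ+}

theorem jordanLength_le (g : GL (Fin n) K) (α : Kˣ) :
    jordanLength K n g ≤ (((α : K) • 1 - (g : Matrix (Fin n) (Fin n) K)).rank : ℝ) / (n : ℕ) :=
  ciInf_le ⟨0, by rintro _ ⟨β, rfl⟩; positivity⟩ α

theorem jordanLength_le_rankLength (g : GL (Fin n) K) : jordanLength K n g ≤ rankLength K n g := by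
  simpa [rankLength] using jordanLength_le g 1

/-- Ranks are natural numbers, so the infimum is attained. -/
theorem exists_rank_div_eq_jordanLength (g : GL (Fin n) K) : ∃ μ : Kˣ,
    (((μ : K) • 1 - (g : Matrix (Fin n) (Fin n) K)).rank : ℝ) / (n : ℕ) = jordanLength K n g ∧
    ∀ β : Kˣ, ((μ : K) • 1 - (g : Matrix (Fin n) (Fin n) K)).rank ≤
      ((β : K) • 1 - (g : Matrix (Fin n) (Fin n) K)).rank := by
  obtain ⟨μ, hμ⟩ := exists_minimalFor_of_wellFoundedLT (fun _ : Kˣ => True)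
    (fun β : Kˣ => ((β : K) • 1 - (g : Matrix (Fin n) (Fin n) K)).rank) ⟨1, trivial⟩
  have hmin : ∀ β : Kˣ, ((μ : K) • 1 - (g : Matrix (Fin n) (Fin n) K)).rank ≤
      ((β : K) • 1 - (g : Matrix (Fin n) (Fin n) K)).rank := fun β =>
    (le_total _ _).elim _root_.id fun h => hμ.2 trivial h
  refine ⟨μ, le_antisymm (le_ciInf fun β => ?_) (jordanLength_le g μ), hmin⟩
  gcongr
  exact hmin β

theorem Matrix.rank_smul_one_sub_reindexAlgEquiv {ι κ : Type*} [Fintype ι] [DecidableEq ι]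
    [Fintype κ] [DecidableEq κ] (e : ι ≃ κ) (α : K) (A : Matrix ι ι K) :
    (α • 1 - Matrix.reindexAlgEquiv K K e A).rank = (α • 1 - A).rank := by
  rw [← Matrix.rank_reindex e e (α • 1 - A), ← Matrix.coe_reindexAlgEquiv K K, map_sub, map_smul,
    map_one]

/-- The homomorphism `g ↦ g ⊗ g`. -/
noncomputable def tensorSquare (K : Type x) [Field K] (n : ℕ+) :
    GL (Fin n) K →* GL (Fin (n * n : ℕ+)) K :=
  Units.map
    { toFun := fun A => Matrix.reindexAlgEquiv K K
        (finProdFinEquiv.trans (finCongr (PNat.mul_coe n n).symm)) (A ⊗ₖ A)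
      map_one' := by rw [Matrix.one_kronecker_one, map_one]
      map_mul' := fun A B => by rw [Matrix.mul_kronecker_mul, map_mul] }

theorem rank_smul_one_sub_tensorSquare (g : GL (Fin n) K) (α : K) :
    (α • 1 - (tensorSquare K n g : Matrix (Fin (n * n : ℕ+)) (Fin (n * n : ℕ+)) K)).rank =
      (α • 1 - (g : Matrix (Fin n) (Fin n) K) ⊗ₖ (g : Matrix (Fin n) (Fin n) K)).rank :=
  Matrix.rank_smul_one_sub_reindexAlgEquiv _ _ _

theorem rank_div_tensorSquare_le (g : GL (Fin n) K) (α : K) :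
    (((α * α) • 1 - (tensorSquare K n g : Matrix (Fin (n * n : ℕ+)) (Fin (n * n : ℕ+)) K)).rank : ℝ) /
        ((n * n : ℕ+) : ℕ) ≤
      2 * (((α • 1 - (g : Matrix (Fin n) (Fin n) K)).rank : ℝ) / (n : ℕ)) := by
  have hn : (0 : ℝ) < (n : ℕ) := by exact_mod_cast n.pos
  have h := Matrix.rank_mul_smul_one_sub_kronecker_le α (g : Matrix (Fin n) (Fin n) K)
  rw [← rank_smul_one_sub_tensorSquare, Fintype.card_fin] at h
  have h' := (Nat.cast_le (α := ℝ)).2 h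
  push_cast at h'
  have hnn : (((n * n : ℕ+) : ℕ) : ℝ) = (n : ℕ) * (n : ℕ) := by rw [PNat.mul_coe, Nat.cast_mul]
  rw [hnn, div_le_iff₀ (by positivity)]
  refine h'.trans (le_of_eq ?_)
  field_simp

theorem rankLength_tensorSquare_le (g : GL (Fin n) K) :
    rankLength K (n * n) (tensorSquare K n g) ≤ 2 * rankLength K n g := by
  have h := rank_div_tensorSquare_le g 1
  rwa [mul_one, one_smul, one_smul] at h

theorem jordanLength_tensorSquare_le (g : GL (Fin n) K) :
    jordanLength K (n * n) (tensorSquare K n g) ≤ 2 * jordanLength K n g := by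
  obtain ⟨μ, hμ, -⟩ := exists_rank_div_eq_jordanLength g
  rw [← hμ]
  exact (jordanLength_le _ (μ * μ)).trans (rank_div_tensorSquare_le g μ)

theorem min_le_jordanLength_tensorSquare (g : GL (Fin n) K) :
    min (1 / 4) (5 / 4 * jordanLength K n g) ≤ jordanLength K (n * n) (tensorSquare K n g) := by
  have hn : (0 : ℝ) < (n : ℕ) := by exact_mod_cast n.pos
  obtain ⟨μ, hμ, hmin⟩ := exists_rank_div_eq_jordanLength g
  refine le_ciInf fun α => ?_
  have key := Matrix.min_le_rank_smul_one_sub_kronecker g μ α hmin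
  rw [← rank_smul_one_sub_tensorSquare, Fintype.card_fin] at key
  have hnn : (((n * n : ℕ+) : ℕ) : ℝ) = (n : ℕ) * (n : ℕ) := by rw [PNat.mul_coe, Nat.cast_mul]
  rw [← hμ, hnn, le_div_iff₀ (by positivity),
    min_mul_of_nonneg _ _ (by positivity)]
  refine le_trans (le_of_eq ?_) key
  congr 1
  · ring
  · field_simp

/-- The homomorphism `g ↦ g ⊕ 1`. -/
noncomputable def directSumOne (K : Type x) [Field K] (n : ℕ+) :
    GL (Fin n) K →* GL (Fin (n + n : ℕ+)) K :=
  Units.map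
    { toFun := fun A => Matrix.reindexAlgEquiv K K
        (finSumFinEquiv.trans (finCongr (PNat.add_coe n n).symm))
        (Matrix.fromBlocks A 0 0 (1 : Matrix (Fin n) (Fin n) K))
      map_one' := by rw [Matrix.fromBlocks_one, map_one]
      map_mul' := fun A B => by
        rw [← map_mul, Matrix.fromBlocks_multiply]
        simp }

theorem rank_smul_one_sub_directSumOne (g : GL (Fin n) K) (α : K) :
    (α • 1 - (directSumOne K n g : Matrix (Fin (n + n : ℕ+)) (Fin (n + n : ℕ+)) K)).rank =
      (Matrix.fromBlocks (α • 1 - (g : Matrix (Fin n) (Fin n) K)) 0 0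
        ((α - 1) • (1 : Matrix (Fin n) (Fin n) K))).rank := by
  have e : Matrix.fromBlocks (α • 1 - (g : Matrix (Fin n) (Fin n) K)) 0 0
      ((α - 1) • (1 : Matrix (Fin n) (Fin n) K)) =
      α • 1 - Matrix.fromBlocks (g : Matrix (Fin n) (Fin n) K) 0 0 1 := by
    rw [← Matrix.fromBlocks_one, Matrix.fromBlocks_smul, sub_eq_add_neg (Matrix.fromBlocks _ _ _ _),
      Matrix.fromBlocks_neg, Matrix.fromBlocks_add]
    simp [← sub_eq_add_neg, sub_smul]
  rw [e]
  exact Matrix.rank_smul_one_sub_reindexAlgEquiv _ _ _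

theorem rankLength_directSumOne_le (g : GL (Fin n) K) :
    rankLength K (n + n) (directSumOne K n g) ≤ rankLength K n g := by
  have h := rank_smul_one_sub_directSumOne g 1
  rw [one_smul, one_smul, sub_self, zero_smul] at h
  have hle : (1 - (directSumOne K n g : Matrix (Fin (n + n : ℕ+)) (Fin (n + n : ℕ+)) K)).rank ≤
      (1 - (g : Matrix (Fin n) (Fin n) K)).rank := by
    rw [h]
    have e : Matrix.fromBlocks (1 - (g : Matrix (Fin n) (Fin n) K)) 0 0
        (0 : Matrix (Fin n) (Fin n) K) =
        Matrix.fromRows (1 : Matrix (Fin n) (Fin n) K) 0 *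
          (1 - (g : Matrix (Fin n) (Fin n) K)) *
            Matrix.fromCols (1 : Matrix (Fin n) (Fin n) K) (0 : Matrix (Fin n) (Fin n) K) := by
      rw [Matrix.fromRows_mul, Matrix.mul_fromCols]
      ext (i | i) (j | j) <;> simp
    rw [e]
    exact (Matrix.rank_mul_le_left _ _).trans (Matrix.rank_mul_le_right _ _)
  unfold rankLength
  have hn : (0 : ℝ) < (n : ℕ) := by exact_mod_cast n.pos
  gcongr
  simp

/-- For `α = 1` the block `1 - g` remains; for `α ≠ 1` the block `α - 1` has full rank `n`. The
factor 2 is the doubled dimension. -/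
theorem rankLength_div_two_le_jordanLength_directSumOne (g : GL (Fin n) K) :
    rankLength K n g / 2 ≤ jordanLength K (n + n) (directSumOne K n g) := by
  have hn : (0 : ℝ) < (n : ℕ) := by exact_mod_cast n.pos
  refine le_ciInf fun α => ?_
  have hle : (1 - (g : Matrix (Fin n) (Fin n) K)).rank ≤
      ((α : K) • 1 - (directSumOne K n g : Matrix (Fin (n + n : ℕ+)) (Fin (n + n : ℕ+)) K)).rank := by
    rw [rank_smul_one_sub_directSumOne]
    by_cases hα : (α : K) = 1
    · rw [hα, one_smul]
      exact Matrix.rank_submatrix_le (Matrix.fromBlocks _ _ _ _) Sum.inl Sum.inl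
    · refine (Matrix.rank_le_card_width _).trans ?_
      refine le_trans ?_ (Matrix.rank_submatrix_le (Matrix.fromBlocks _ _ _ _) Sum.inr Sum.inr)
      have e : (Matrix.fromBlocks ((α : K) • 1 - (g : Matrix (Fin n) (Fin n) K)) 0 0
        (((α : K) - 1) • (1 : Matrix (Fin n) (Fin n) K))).submatrix Sum.inr Sum.inr =
        ((α : K) - 1) • (1 : Matrix (Fin n) (Fin n) K) := rfl
      rw [e, Matrix.rank_of_det_ne_zero]
      simpa using sub_ne_zero.2 hα
  have hle' : ((1 - (g : Matrix (Fin n) (Fin n) K)).rank : ℝ) ≤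
      ((α : K) • 1 - (directSumOne K n g : Matrix (Fin (n + n : ℕ+)) (Fin (n + n : ℕ+)) K)).rank := by
    exact_mod_cast hle
  have hnn : (((n + n : ℕ+) : ℕ) : ℝ) = (n : ℕ) * 2 := by
    rw [PNat.add_coe, Nat.cast_add, mul_two]
  rw [rankLength, hnn, div_div]
  gcongr

/-- Iterated tensor squares amplify the Jordan length up to `1 / 4`. -/
theorem exists_iterated_tensorSquare (K : Type x) [Field K] (i : ℕ) (n : ℕ+) :
    ∃ (m : ℕ+) (κ : GL (Fin n) K →* GL (Fin m) K), ∀ g,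
      rankLength K m (κ g) ≤ 2 ^ i * rankLength K n g ∧
      jordanLength K m (κ g) ≤ 2 ^ i * jordanLength K n g ∧
      min (1 / 4) ((5 / 4) ^ i * jordanLength K n g) ≤ jordanLength K m (κ g) := by
  induction i with
  | zero => exact ⟨n, MonoidHom.id _, fun g => by simp⟩
  | succ i ih =>
    obtain ⟨m, κ, hκ⟩ := ih
    refine ⟨m * m, (tensorSquare K m).comp κ, fun g => ?_⟩
    obtain ⟨h1, h2, h3⟩ := hκ g
    have h1' := rankLength_tensorSquare_le (κ g)
    have h2' := jordanLength_tensorSquare_le (κ g)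
    have h3' := min_le_jordanLength_tensorSquare (κ g)
    simp only [MonoidHom.comp_apply]
    refine ⟨?_, ?_, le_trans (le_min (min_le_left _ _) ?_) h3'⟩
    · rw [pow_succ]; linarith
    · rw [pow_succ]; linarith
    · rw [pow_succ]
      rcases min_le_iff.1 h3 with h | h
      · exact (min_le_left _ _).trans (by linarith)
      · exact (min_le_right _ _).trans (by linarith)

end Lengths

/-! ### Amplification of almost homomorphisms. -/

theorem IsAlmostHom.comp_monoidHom {Γ : Type u} [Group Γ] {G : Type v} [Group G] {H : Type w}
    [Group H] {ℓ : G → ℝ} {ℓ' : H → ℝ} {d : Γ → ℝ} {E : Finset Γ} {ε C δ : ℝ} {φ : Γ → G}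
    (hφ : IsAlmostHom ℓ d E ε φ) (hC : 0 ≤ C) (κ : G →* H) (hκ : ∀ g, ℓ' (κ g) ≤ C * ℓ g)
    (hδ : ∀ g ∈ E, g ≠ 1 → δ ≤ ℓ' (κ (φ g))) :
    IsAlmostHom ℓ' (fun _ => δ) E (C * ε) (κ ∘ φ) where
  length_map_one_le := (hκ _).trans (mul_le_mul_of_nonneg_left hφ.length_map_one_le hC)
  le_length_map := hδ
  length_defect_le g hg h hh := by
    simp only [Function.comp_apply]
    rw [← map_inv, ← map_mul, ← map_mul]
    exact (hκ _).trans (mul_le_mul_of_nonneg_left (hφ.length_defect_le g hg h hh) hC)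

theorem exists_le_pow_mul {c : ℝ} (hc : 0 < c) : ∃ i : ℕ, (1 / 4 : ℝ) ≤ (5 / 4) ^ i * c := by
  obtain ⟨i, hi⟩ := pow_unbounded_of_one_lt (1 / 4 / c) (by norm_num : (1 : ℝ) < 5 / 4)
  exact ⟨i, ((div_lt_iff₀ hc).1 hi).le⟩

/-- The amplification property with an explicit universal constant `δ`. -/
def AmplifiesTo {I : Type w} (G : I → Type v) [∀ i, Group (G i)] (ℓ : ∀ i, G i → ℝ) (δ : ℝ) :
    Prop :=
  ∀ (Γ : Type u) [Group Γ] (d : Γ → ℝ) (ε : ℝ), 0 < ε → ∀ c : ℝ, 0 < c → ∃ ε' : ℝ, 0 < ε' ∧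
    ∀ E : Finset Γ, (∀ g ∈ E, g ≠ 1 → c ≤ d g) →
    ∀ (i : I) (φ : Γ → G i), IsAlmostHom (ℓ i) d E ε' φ →
      ∃ (j : I) (κ : G i → G j), IsAlmostHom (ℓ j) (fun _ => δ) E ε (κ ∘ φ)

theorem jordanLength_amplifiesTo (K : Type x) [Field K] :
    AmplifiesTo.{u} (fun n : ℕ+ => GL (Fin n) K) (jordanLength K) (1 / 4) := by
  intro Γ _ d ε hε c hc
  obtain ⟨i, hi⟩ := exists_le_pow_mul hc
  refine ⟨ε / 2 ^ i, by positivity, fun E hE n φ hφ => ?_⟩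
  obtain ⟨m, κ, hκ⟩ := exists_iterated_tensorSquare K i n
  refine ⟨m, κ, ?_⟩
  have key := hφ.comp_monoidHom (C := 2 ^ i) (δ := 1 / 4) (by positivity) κ (fun g => (hκ g).2.1)
    fun g hg hg1 => le_trans (le_min le_rfl (hi.trans ?_)) (hκ (φ g)).2.2
  · rwa [mul_div_cancel₀ _ (by positivity)] at key
  · gcongr
    exact (hE g hg hg1).trans (hφ.le_length_map g hg hg1)

theorem rankLength_amplifiesTo (K : Type x) [Field K] :
    AmplifiesTo.{u} (fun n : ℕ+ => GL (Fin n) K) (rankLength K) (1 / 4) := by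
  intro Γ _ d ε hε c hc
  -- Passing to `g ⊕ 1` leaves only `c / 2` as a lower bound for the Jordan length.
  obtain ⟨i, hi⟩ := exists_le_pow_mul (half_pos hc)
  refine ⟨ε / 2 ^ i, by positivity, fun E hE n φ hφ => ?_⟩
  obtain ⟨m, κ, hκ⟩ := exists_iterated_tensorSquare K i (n + n)
  refine ⟨m, κ.comp (directSumOne K n), ?_⟩
  have key := hφ.comp_monoidHom (C := 2 ^ i) (δ := 1 / 4) (ℓ' := rankLength K m) (by positivity)
    (κ.comp (directSumOne K n))
    (fun g => (hκ _).1.trans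
      (mul_le_mul_of_nonneg_left (rankLength_directSumOne_le g) (by positivity)))
    fun g hg hg1 => le_trans (le_trans (le_min le_rfl (hi.trans ?_)) (hκ _).2.2)
      (jordanLength_le_rankLength _)
  · rwa [mul_div_cancel₀ _ (by positivity)] at key
  · refine le_trans ?_ (mul_le_mul_of_nonneg_left
      (rankLength_div_two_le_jordanLength_directSumOne (φ g)) (by positivity))
    gcongr
    exact (hE g hg hg1).trans (hφ.le_length_map g hg hg1)

theorem AmplifiesTo.amplificationProperty {I : Type w} {G : I → Type v} [∀ i, Group (G i)]
    {ℓ : ∀ i, G i → ℝ} {δ : ℝ} (h : AmplifiesTo.{u} G ℓ δ) (hδ : 0 < δ) :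
    AmplificationProperty.{u} G ℓ :=
  ⟨δ, hδ, fun Γ _ d _ ε hε c hc => h Γ d ε hε c hc⟩

theorem AmplifiesTo.exists_isAlmostHom {I : Type w} {G : I → Type v} [∀ i, Group (G i)]
    {ℓ : ∀ i, G i → ℝ} {δ : ℝ} (h : AmplifiesTo.{u} G ℓ δ) {Γ : Type u} [Group Γ]
    (hΓ : ApproximationProperty G ℓ Γ) (E : Finset Γ) {ε : ℝ} (hε : 0 < ε) :
    ∃ (i : I) (φ : Γ → G i), IsAlmostHom (ℓ i) (fun _ => δ) E ε φ := by
  obtain ⟨d, hd, happrox⟩ := hΓ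
  -- Finiteness of `E` gives a common positive lower bound.
  have hc : ∃ c : ℝ, 0 < c ∧ ∀ g ∈ E, g ≠ 1 → c ≤ d g := by
    have hall : ∀ᶠ c : ℝ in nhdsWithin 0 (Set.Ioi 0), ∀ g ∈ E, g ≠ 1 → c ≤ d g := by
      rw [Filter.eventually_all_finset]
      intro g _
      by_cases hg : g = 1
      · exact Filter.Eventually.of_forall fun _ h => absurd hg h
      · filter_upwards [Ioo_mem_nhdsGT (hd g hg)] with c hc _ using hc.2.le
    obtain ⟨c, hc, hc0⟩ := (hall.and self_mem_nhdsWithin).exists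
    exact ⟨c, hc0, hc⟩
  obtain ⟨c, hc0, hc⟩ := hc
  obtain ⟨ε', hε', hamp⟩ := h Γ d ε hε c hc0
  obtain ⟨i, φ, hφ⟩ := happrox ε' hε' E
  obtain ⟨j, κ, hκ⟩ := hamp E hc i φ hφ
  exact ⟨j, κ ∘ φ, hκ⟩

theorem mainTheorem2 (K : Type x) [Field K] :
    AmplificationProperty.{u} (fun n : ℕ+ => GL (Fin n) K) (rankLength K) ∧
    AmplificationProperty.{u} (fun n : ℕ+ => GL (Fin n) K) (jordanLength K) ∧
    (∀ (Γ : Type u) [Group Γ], IsProjectivelySoficOver K Γ →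
      ∃ d : Γ → ℝ, (∀ g : Γ, g ≠ 1 → 0 < d g) ∧
        ∀ (E : Finset Γ) (ε : ℝ), 0 < ε →
          ∃ (n : ℕ+) (φ : Γ → GL (Fin n) K), IsAlmostHom (jordanLength K n) d E ε φ ∧
            ∀ g ∈ E, g ≠ 1 → 1 / 4 - ε < jordanLength K n (φ g)) ∧
    (∀ (Γ : Type u) [Group Γ], IsSoficOver K Γ →
      ∃ d : Γ → ℝ, (∀ g : Γ, g ≠ 1 → 0 < d g) ∧
        ∀ (E : Finset Γ) (ε : ℝ), 0 < ε →
          ∃ (n : ℕ+) (φ : Γ → GL (Fin n) K), IsAlmostHom (rankLength K n) d E ε φ ∧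
            ∀ g ∈ E, g ≠ 1 → 1 / 8 - ε < rankLength K n (φ g)) := by
  refine ⟨(rankLength_amplifiesTo K).amplificationProperty (by norm_num),
    (jordanLength_amplifiesTo K).amplificationProperty (by norm_num), fun Γ _ hΓ => ?_,
    fun Γ _ hΓ => ?_⟩
  · refine ⟨fun _ => 1 / 4, fun _ _ => by norm_num, fun E ε hε => ?_⟩
    obtain ⟨n, φ, hφ⟩ := (jordanLength_amplifiesTo K).exists_isAlmostHom hΓ E hε
    exact ⟨n, φ, hφ, fun g hg hg1 => by have := hφ.le_length_map g hg hg1; linarith⟩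
  -- The halving occurs before the squarings, which make up for it, so even `1 / 4` holds in place
  -- of `1 / 8`.
  · refine ⟨fun _ => 1 / 4, fun _ _ => by norm_num, fun E ε hε => ?_⟩
    obtain ⟨n, φ, hφ⟩ := (rankLength_amplifiesTo K).exists_isAlmostHom hΓ E hε
    exact ⟨n, φ, hφ, fun g hg hg1 => by have := hφ.le_length_map g hg hg1; linarith⟩
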